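/- Let $G$ be a finite simple undirected graph with $n$ vertices. Call $G$ \emph{mock threshold} if its vertices can be ordered $v_1,\dots,v_n$ so that, for every $i$ with $1\le i\le n$, the degree of $v_i$ in the induced subgraph $G[v_1,\dots,v_i]$ is $0$, $1$, $i-2$ or $i-1$. A \emph{total coloring} of $G$ is a map $f\colon V(G)\cup E(G)\to C$ to a set $C$ of colors such that $f(u)\ne f(v)$ for any two adjacent vertices $u,v$, $f(e)\ne f(e')$ for any two distinct edges $e,e'$ with a common end, and $f(v)\ne f(e)$ for any vertex $v$ and any edge $e$ incident to $v$. The \emph{total chromatic number} $\chi''(G)$ is the minimum number of colors that suffice in a total coloring of $G$, and $\Delta(G)$ is the maximum degree of $G$. Theorem. The total coloring conjecture holds for every mock threshold graph: if $G$ is mock threshold, then $$\chi''(G)\le \Delta(G)+2 .$$ -/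

import Mathlib

namespace SimpleGraph

/-- A total coloring of `G` with colors in `C`: a map on the disjoint union of the vertices and the
edges of `G` giving distinct colors to adjacent vertices, to adjacent edges (distinct edges with
a common end), and to a vertex and an edge incident to it. -/
structure TotalColoring {V : Type*} (G : SimpleGraph V) (C : Type*) where
  toFun : V ⊕ G.edgeSet → C
  vertex_vertex : ∀ u v : V, G.Adj u v → toFun (Sum.inl u) ≠ toFun (Sum.inl v)
  edge_edge : ∀ e e' : G.edgeSet, e ≠ e' → (∃ v : V, v ∈ (e : Sym2 V) ∧ v ∈ (e' : Sym2 V)) →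
    toFun (Sum.inr e) ≠ toFun (Sum.inr e')
  vertex_edge : ∀ (v : V) (e : G.edgeSet), v ∈ (e : Sym2 V) →
    toFun (Sum.inl v) ≠ toFun (Sum.inr e)

/-- The total chromatic number: the least number of colors of a total coloring of `G`
(`⊤` if no finite number of colors suffices). -/
noncomputable def totalChromaticNumber {V : Type*} (G : SimpleGraph V) : ℕ∞ :=
  ⨅ n ∈ {n : ℕ | Nonempty (G.TotalColoring (Fin n))}, (n : ℕ∞)

open Classical in
/-- The degree of the `i`-th vertex of the ordering `σ` in the subgraph of `G` induced by the
vertices up to and including that one. -/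
noncomputable def initialDegree {V : Type*} (G : SimpleGraph V) {n : ℕ} (σ : Fin n ≃ V)
    (i : Fin n) : ℕ :=
  letI : Fintype V := Fintype.ofEquiv (Fin n) σ
  (G.induce (σ '' Set.Iic i)).degree ⟨σ i, Set.mem_image_of_mem σ (Set.mem_Iic.mpr le_rfl)⟩

/-- `G` is mock threshold if its vertices have an ordering `v_1, …, v_n` such that the degree of
each `v_i` in `G[v_1, …, v_i]` is `0`, `1`, `i - 2` or `i - 1`. Positions in `Fin n` start at `0`,
so `v_i` is at position `i - 1`; the last two degrees are written without subtraction. -/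
def IsMockThreshold {V : Type*} [Fintype V] (G : SimpleGraph V) : Prop :=
  ∃ σ : Fin (Fintype.card V) ≃ V, ∀ i : Fin (Fintype.card V),
    G.initialDegree σ i = 0 ∨ G.initialDegree σ i = 1 ∨
      G.initialDegree σ i + 1 = (i : ℕ) ∨ G.initialDegree σ i = (i : ℕ)

end SimpleGraph

/-!
Insert the vertices in the given order, keeping `Δ + 2` colors. A vertex with at most one earlier
neighbor `u` is attached greedily: the new edge avoids `u` and fewer than `Δ` edges at `u`, and the
new vertex avoids `u` and the new edge. A vertex with more earlier neighbors is adjacent to all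
earlier vertices but at most one, so at most `Δ + 2` vertices are present and they are colored
afresh.

With `n` vertices labelled in `ℤ/N`, `N ≥ n` odd, coloring both `x` and `xy` by sums of labels
`x + x` and `x + y` is a total coloring. This leaves the case of `n = N + 1 = Δ + 2` even, where no
vertex is universal and `N + 1` colors are available. Use the round-robin edge coloring of the
complete graph with `N` colors, and give each vertex the color of an edge of a spanning star forest
of the complement. If the vertices are numbered with the centers first and the leaves after them, in
the order of their centers, the star edges get distinct colors, except for the edge at the last
leaf, whose ends take the one color left over.
-/

open SimpleGraph

/-- Total colorability with `k` colors. -/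
def TotalColorable {V : Type*} (G : SimpleGraph V) (k : ℕ) : Prop :=
  Nonempty (G.TotalColoring (Fin k))

/-- A spanning star forest of `H` without trivial stars, encoded by its set of leaves and a map
that sends a leaf to the center of its star and a center to one of the leaves of its star. -/
structure StarForest {V : Type*} (H : SimpleGraph V) where
  leaves : Set V
  partner : V → V
  adj_partner : ∀ x, H.Adj x (partner x)
  partner_notMem_leaves : ∀ x ∈ leaves, partner x ∉ leaves
  partner_mem_leaves : ∀ x ∉ leaves, partner x ∈ leaves
  partner_partner : ∀ x ∉ leaves, partner (partner x) = x

section TotalColorable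

variable {V W : Type*} {G : SimpleGraph V} {H : SimpleGraph W} {k l : ℕ}

theorem TotalColorable.totalChromaticNumber_le (h : TotalColorable G k) :
    G.totalChromaticNumber ≤ k :=
  iInf₂_le k h

theorem totalColorable_iff_exists_sym2 :
    TotalColorable G k ↔ ∃ (f : V → Fin k) (c : Sym2 V → Fin k),
      (∀ u v, G.Adj u v → f u ≠ f v) ∧ (∀ u v, G.Adj u v → f u ≠ c s(u, v)) ∧
        ∀ u v w, G.Adj u v → G.Adj u w → v ≠ w → c s(u, v) ≠ c s(u, w) := by
  classical
  constructor
  · rintro ⟨T⟩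
    -- Outside the edge set `c` needs some value, and `Fin k` might be empty.
    refine ⟨fun v => T.toFun (.inl v), fun e =>
      if he : e ∈ G.edgeSet then T.toFun (.inr ⟨e, he⟩) else T.toFun (.inl e.out.1),
      T.vertex_vertex, fun u v huv => ?_, fun u v w huv huw hvw => ?_⟩
    · simpa only [mem_edgeSet, huv, dite_true] using
        T.vertex_edge u ⟨s(u, v), huv⟩ (Sym2.mem_mk_left u v)
    · simpa only [mem_edgeSet, huv, huw, dite_true] using
        T.edge_edge ⟨s(u, v), huv⟩ ⟨s(u, w), huw⟩
          (fun h => hvw (Sym2.congr_right.1 (Subtype.ext_iff.1 h)))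
          ⟨u, Sym2.mem_mk_left u v, Sym2.mem_mk_left u w⟩
  · rintro ⟨f, c, hvertex, hincident, hedge⟩
    refine ⟨⟨Sum.elim f fun e => c e, hvertex, ?_, ?_⟩⟩
    · rintro ⟨_, huv⟩ ⟨_, huw⟩ hne ⟨u, ⟨v, rfl⟩, ⟨w, rfl⟩⟩
      exact hedge u v w huv huw fun hvw => hne (by rw [Subtype.mk.injEq, hvw])
    · rintro u ⟨_, huv⟩ ⟨v, rfl⟩
      exact hincident u v huv

theorem totalColorable_of_sym2 {C : Type*} [Fintype C] (hk : Fintype.card C ≤ k)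
    (f : V → C) (c : Sym2 V → C) (hvertex : ∀ u v, G.Adj u v → f u ≠ f v)
    (hincident : ∀ u v, G.Adj u v → f u ≠ c s(u, v))
    (hedge : ∀ u v w, G.Adj u v → G.Adj u w → v ≠ w → c s(u, v) ≠ c s(u, w)) :
    TotalColorable G k := by
  obtain ⟨φ⟩ : Nonempty (C ↪ Fin k) := Function.Embedding.nonempty_of_card_le (by simpa using hk)
  exact totalColorable_iff_exists_sym2.2 ⟨φ ∘ f, φ ∘ c,
    fun u v huv => φ.injective.ne (hvertex u v huv),
    fun u v huv => φ.injective.ne (hincident u v huv),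
    fun u v w huv huw hvw => φ.injective.ne (hedge u v w huv huw hvw)⟩

theorem TotalColorable.mono_colors (h : TotalColorable G k) (hkl : k ≤ l) :
    TotalColorable G l := by
  obtain ⟨f, c, hvertex, hincident, hedge⟩ := totalColorable_iff_exists_sym2.1 h
  exact totalColorable_of_sym2 (by simpa using hkl) f c hvertex hincident hedge

theorem TotalColorable.comap (h : TotalColorable H k) (φ : G →g H)
    (hφ : ∀ v, Set.InjOn φ (G.neighborSet v)) : TotalColorable G k := by
  obtain ⟨f, c, hvertex, hincident, hedge⟩ := totalColorable_iff_exists_sym2.1 h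
  refine totalColorable_iff_exists_sym2.2 ⟨f ∘ φ, c ∘ Sym2.map φ,
    fun u v huv => hvertex _ _ (φ.map_adj huv), fun u v huv => hincident _ _ (φ.map_adj huv),
    fun u v w huv huw hvw => hedge _ _ _ (φ.map_adj huv) (φ.map_adj huw) ?_⟩
  exact (hφ u).ne huv huw hvw

theorem TotalColorable.mono {G' : SimpleGraph V} (h : TotalColorable G' k) (hle : G ≤ G') :
    TotalColorable G k :=
  h.comap (Hom.ofLE hle) fun _ => Function.injective_id.injOn

theorem TotalColorable.spanningCoe {S : Set V} [Nonempty S] {K : SimpleGraph S}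
    (h : TotalColorable K k) : TotalColorable K.spanningCoe k := by
  have hleft : Function.LeftInverse (Function.invFun ((↑) : S → V)) (↑) :=
    Function.leftInverse_invFun Subtype.val_injective
  have hadj : ∀ u v, K.spanningCoe.Adj u v → ∃ x y : S, K.Adj x y ∧ (x : V) = u ∧ (y : V) = v :=
    fun u v huv => (map_adj _ _ u v).1 huv
  refine h.comap ⟨Function.invFun ((↑) : S → V), ?_⟩ ?_
  · rintro u v huv
    obtain ⟨x, y, hxy, rfl, rfl⟩ := hadj u v huv
    rwa [hleft, hleft]
  · rintro u v huv w huw hvw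
    obtain ⟨-, y, -, -, rfl⟩ := hadj u v huv
    obtain ⟨-, z, -, -, rfl⟩ := hadj u w huw
    exact congrArg Subtype.val ((hleft y).symm.trans (hvw.trans (hleft z)))

theorem totalColorable_bot [NeZero k] : TotalColorable (⊥ : SimpleGraph V) k :=
  totalColorable_iff_exists_sym2.2 ⟨0, 0, fun _ _ h => h.elim, fun _ _ h => h.elim,
    fun _ _ _ h => h.elim⟩

theorem TotalColorable.sup_edge {u v : V} [Fintype (G.neighborSet u)] (h : TotalColorable G k)
    (huv : u ≠ v) (hv : G.IsIsolated v) (hdeg : G.degree u + 1 < k) (hk : 2 < k) :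
    TotalColorable (G ⊔ edge u v) k := by
  classical
  obtain ⟨f, c, hvertex, hincident, hedge⟩ := totalColorable_iff_exists_sym2.1 h
  obtain ⟨a, hau, ha⟩ : ∃ a, a ≠ f u ∧ ∀ x, G.Adj u x → a ≠ c s(u, x) := by
    have hcard : (insert (f u) ((G.neighborFinset u).image fun x => c s(u, x))).card <
        (Finset.univ : Finset (Fin k)).card := by
      rw [Finset.card_fin]
      exact (Finset.card_insert_le _ _).trans_lt
        ((Nat.succ_le_succ Finset.card_image_le).trans_lt hdeg)
    obtain ⟨a, -, ha⟩ := Finset.exists_mem_notMem_of_card_lt_card hcard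
    simp only [Finset.mem_insert, Finset.mem_image, mem_neighborFinset, not_or, not_exists,
      not_and] at ha
    exact ⟨a, ha.1, fun x hx h => ha.2 x hx h.symm⟩
  obtain ⟨b, hbu, hba⟩ : ∃ b, b ≠ f u ∧ b ≠ a := by
    simpa using Finset.exists_mem_notMem_of_card_lt_card
      (s := {f u, a}) (t := Finset.univ) (Finset.card_le_two.trans_lt (by simpa using hk))
  have hnotAdj : ∀ x, ¬ G.Adj v x := hv
  refine totalColorable_iff_exists_sym2.2
    ⟨Function.update f v b, Function.update c s(u, v) a, ?_, ?_, ?_⟩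
  all_goals
    simp only [sup_adj, edge_adj, Function.update_apply, Sym2.eq_iff]
    grind [SimpleGraph.adj_comm]

end TotalColorable

section Latin

variable {V A : Type*} {G : SimpleGraph V} [AddCommMagma A] [IsLeftCancelAdd A] [Fintype A]

theorem totalColorable_card_of_injective_add_self {label : V → A}
    (hlabel : Function.Injective label) (hdouble : Function.Injective fun a : A => a + a) :
    TotalColorable G (Fintype.card A) := by
  refine totalColorable_of_sym2 le_rfl (fun x => label x + label x)
    (Sym2.lift ⟨fun x y => label x + label y, fun x y => add_comm _ _⟩) ?_ ?_ ?_
  · exact fun u v huv h => huv.ne (hlabel (hdouble h))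
  · exact fun u v huv h => huv.ne (hlabel (add_left_cancel h))
  · exact fun u v w _ _ hvw h => hvw (hlabel (add_left_cancel h))

end Latin

section RoundRobin

variable {V A : Type*} [AddCommMagma A] {label : V → A} {l : V}

open Classical in
/-- The round-robin edge coloring of the complete graph on `V`: an edge gets the sum of the labels
of its ends, except that the special vertex `l` borrows the label of the other end. -/
noncomputable def roundRobin (label : V → A) (l : V) : Sym2 V → A :=
  Sym2.lift ⟨fun x y => label (if x = l then y else x) + label (if y = l then x else y),
    fun _ _ => add_comm _ _⟩

theorem roundRobin_of_ne {x y : V} (hx : x ≠ l) (hy : y ≠ l) :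
    roundRobin label l s(x, y) = label x + label y := by
  simp [roundRobin, hx, hy]

theorem roundRobin_injOn [IsLeftCancelAdd A] (hlabel : Set.InjOn label {l}ᶜ)
    (hdouble : Function.Injective fun a : A => a + a) (x : V) :
    Set.InjOn (fun y => roundRobin label l s(x, y)) {x}ᶜ := by
  classical
  intro y (hy : y ≠ x) z (hz : z ≠ x) h
  by_cases hx : x = l
  · subst hx
    have hyz : label y + label y = label z + label z := by simpa [roundRobin, hy, hz] using h
    exact hlabel hy hz (hdouble hyz)
  · have hyz : (if y = l then x else y) = if z = l then x else z := by
      refine hlabel ?_ ?_ (add_left_cancel (a := label x) (by simpa [roundRobin, hx] using h))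
      all_goals grind
    grind

end RoundRobin

section StarForest

variable {V : Type*} {G H : SimpleGraph V}

theorem exists_le_forall_adj_neighborSet_subsingleton [Finite V] (hH : ∀ x, ¬ H.IsIsolated x) :
    ∃ F ≤ H, (∀ x, ¬ F.IsIsolated x) ∧
      ∀ x y, F.Adj x y → (F.neighborSet x).Subsingleton ∨ (F.neighborSet y).Subsingleton := by
  obtain ⟨F, hFH, hF, hmin⟩ :=
    exists_minimal_le_of_wellFoundedLT (fun F : SimpleGraph V => ∀ x, ¬ F.IsIsolated x) H hH
  refine ⟨F, hFH, hF, fun x y hxy => ?_⟩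
  by_contra! hnot
  have hcover : ∀ z, ¬ (F.deleteEdges {s(x, y)}).IsIsolated z := by
    intro z
    simp only [← exists_adj_iff_not_isIsolated, deleteEdges_adj, Set.mem_singleton_iff, Sym2.eq_iff]
    obtain ⟨w, hzw⟩ := exists_adj_iff_not_isIsolated.2 (hF z)
    obtain ⟨x', hx', hxx'⟩ := hnot.1.exists_ne y
    obtain ⟨y', hy', hyy'⟩ := hnot.2.exists_ne x
    simp only [mem_neighborSet] at hx' hy'
    grind
  simpa using hmin hcover (deleteEdges_le _) hxy

theorem nonempty_starForest [Finite V] (hH : ∀ x, ¬ H.IsIsolated x) : Nonempty (StarForest H) := by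
  obtain ⟨F, hFH, hF, hpendant⟩ := exists_le_forall_adj_neighborSet_subsingleton hH
  -- Both ends of a single-edge component are pendant; maximality picks exactly one of them.
  obtain ⟨L, ⟨hLpendant, hLindep⟩, hLmax⟩ := exists_maximal_of_wellFoundedGT
    (fun L : Set V => (∀ x ∈ L, (F.neighborSet x).Subsingleton) ∧ F.IsIndepSet L)
    ⟨∅, by simp⟩
  have hmem : ∀ x, (F.neighborSet x).Subsingleton → (∀ y ∈ L, ¬ F.Adj x y) → x ∈ L := by
    intro x hx hxL
    refine hLmax (y := insert x L) ⟨?_, ?_⟩ (Set.subset_insert x L) (Set.mem_insert x L)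
    · exact Set.forall_mem_insert.2 ⟨hx, hLpendant⟩
    · exact hLindep.insert fun y hy _ => ⟨hxL y hy, fun h => hxL y hy h.symm⟩
  have hcover : ∀ x ∉ L, ∀ y, F.Adj x y → y ∈ L := by
    intro x hx y hxy
    rcases hpendant x y hxy with hx' | hy'
    · by_contra hy
      exact hx (hmem x hx' fun z hz hxz => hy (hx' hxz hxy ▸ hz))
    · exact hmem y hy' fun z hz hyz => hx (hy' hyz hxy.symm ▸ hz)
  choose p hadj using fun x => exists_adj_iff_not_isIsolated.2 (hF x)
  exact ⟨⟨L, p, fun x => hFH (hadj x), fun x hx hpx => hLindep hx hpx (hadj x).ne (hadj x),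
    fun x hx => hcover x hx _ (hadj x),
    fun x hx => hLpendant _ (hcover x hx _ (hadj x)) (hadj _) (hadj x).symm⟩⟩

namespace StarForest

variable (F : StarForest H)

/-- The edge of the forest joining `x` to its partner. -/
def edge (x : V) : Sym2 V := s(x, F.partner x)

theorem exists_mem_leaves_edge_eq (x : V) : ∃ y ∈ F.leaves, F.edge y = F.edge x := by
  by_cases hx : x ∈ F.leaves
  · exact ⟨x, hx, rfl⟩
  · exact ⟨F.partner x, F.partner_mem_leaves x hx, by
      rw [edge, edge, F.partner_partner x hx, Sym2.eq_swap]⟩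

theorem edge_eq_of_mem_leaves {l x : V} (hl : l ∈ F.leaves) (hlx : l ∈ F.edge x) :
    F.edge x = F.edge l := by
  rcases Sym2.mem_iff.1 hlx with rfl | rfl
  · rfl
  · have hx : x ∉ F.leaves := fun hx => F.partner_notMem_leaves x hx hl
    rw [edge, edge, F.partner_partner x hx, Sym2.eq_swap]

theorem adj_or_eq_of_edge_eq {x y : V} (h : F.edge x = F.edge y) : x = y ∨ H.Adj x y := by
  rcases Sym2.eq_iff.1 h with ⟨hxy, -⟩ | ⟨-, hxy⟩
  · exact Or.inl hxy
  · exact Or.inr (hxy ▸ F.adj_partner x)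

end StarForest

theorem totalColorable_of_starForest_compl {C : Type*} [Fintype C] (c : Sym2 V → C)
    (hc : ∀ x, Set.InjOn (fun y => c s(x, y)) {x}ᶜ) (F : StarForest Gᶜ) {l : V}
    (hl : l ∈ F.leaves) (hF : Set.InjOn (fun x => c (F.edge x)) (F.leaves \ {l})) :
    TotalColorable G (Fintype.card C + 1) := by
  classical
  have hedge : ∀ x y, l ∉ F.edge x → l ∉ F.edge y → c (F.edge x) = c (F.edge y) →
      F.edge x = F.edge y := by
    intro x y hx hy h
    obtain ⟨x', hx', hxx'⟩ := F.exists_mem_leaves_edge_eq x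
    obtain ⟨y', hy', hyy'⟩ := F.exists_mem_leaves_edge_eq y
    rw [← hxx'] at hx h ⊢
    rw [← hyy'] at hy h ⊢
    have hne : ∀ z, l ∉ F.edge z → z ≠ l := by
      rintro z hz rfl
      exact hz (Sym2.mem_mk_left _ _)
    rw [hF ⟨hx', hne x' hx⟩ ⟨hy', hne y' hy⟩ h]
  -- Each vertex receives the color of its forest edge, which is not an edge of `G`. The forest edge
  -- at `l` may repeat a color, so its ends receive the extra color `none`.
  refine totalColorable_of_sym2 (C := Option C) (by simp)
    (fun x => if l ∈ F.edge x then none else some (c (F.edge x))) (fun e => some (c e)) ?_ ?_ ?_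
  · intro u v huv h
    have hne : ¬ (u = v ∨ Gᶜ.Adj u v) := by simp [huv, huv.ne]
    refine hne (F.adj_or_eq_of_edge_eq ?_)
    by_cases hu : l ∈ F.edge u <;> by_cases hv : l ∈ F.edge v
    · rw [F.edge_eq_of_mem_leaves hl hu, F.edge_eq_of_mem_leaves hl hv]
    · simp [hu, hv] at h
    · simp [hu, hv] at h
    · exact hedge u v hu hv (by simpa [hu, hv] using h)
  · intro u v huv h
    have hcuv : c s(u, F.partner u) = c s(u, v) := by
      split_ifs at h
      exact Option.some_injective _ h
    have hpartner := hc u (F.adj_partner u).ne' huv.ne' hcuv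
    exact ((compl_adj G u v).1 (hpartner ▸ F.adj_partner u)).2 huv
  · exact fun u v w huv huw hvw h => hvw (hc u huv.ne' huw.ne' (Option.some_injective _ h))

theorem exists_equiv_fin_lt_of_lt [Fintype V] {n : ℕ} (hn : Fintype.card V = n) {α : Type*}
    [LinearOrder α] (key : V → α) : ∃ e : V ≃ Fin n, ∀ x y, key x < key y → e x < e y := by
  let i := Fintype.equivFinOfCardEq hn
  refine ⟨i.trans (Tuple.sort (key ∘ i.symm)).symm, fun x y => ?_⟩
  contrapose!
  intro h
  simpa using Tuple.monotone_sort (key ∘ i.symm) h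

theorem StarForest.exists_equiv_fin_monotone [Fintype V] {n : ℕ} (hn : Fintype.card V = n)
    (F : StarForest H) :
    ∃ e : V ≃ Fin n, (∀ x ∉ F.leaves, ∀ y ∈ F.leaves, e x < e y) ∧
      ∀ x ∈ F.leaves, ∀ y ∈ F.leaves, e x ≤ e y → e (F.partner x) ≤ e (F.partner y) := by
  classical
  let i := Fintype.equivFinOfCardEq hn
  let key : V → ℕ := fun x => if x ∈ F.leaves then n + i (F.partner x) else i x
  have hleaf : ∀ x ∈ F.leaves, key x = n + i (F.partner x) := fun x hx => if_pos hx
  have hcenter : ∀ x ∉ F.leaves, key x = i x := fun x hx => if_neg hx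
  obtain ⟨e, he⟩ := exists_equiv_fin_lt_of_lt hn key
  refine ⟨e, fun x hx y hy => he x y ?_, fun x hx y hy => ?_⟩
  · rw [hleaf y hy, hcenter x hx]
    omega
  · contrapose!
    intro hlt
    have hle : key (F.partner y) ≤ key (F.partner x) := not_lt.1 fun h => hlt.not_gt (he _ _ h)
    have hne : i (F.partner y) ≠ i (F.partner x) := fun h => hlt.ne (by rw [i.injective h])
    rw [hcenter _ (F.partner_notMem_leaves y hy), hcenter _ (F.partner_notMem_leaves x hx)] at hle
    refine he y x ?_
    rw [hleaf x hx, hleaf y hy]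
    omega

theorem StarForest.natCast_add_injOn (F : StarForest H) {N : ℕ}
    {e : V ≃ Fin (N + 1)} (hlt : ∀ x ∉ F.leaves, ∀ y ∈ F.leaves, e x < e y)
    (hle : ∀ x ∈ F.leaves, ∀ y ∈ F.leaves, e x ≤ e y → e (F.partner x) ≤ e (F.partner y)) :
    Set.InjOn (fun x => ((e x : ℕ) : ZMod N) + ((e (F.partner x) : ℕ) : ZMod N))
      (F.leaves \ {e.symm (Fin.last N)}) := by
  -- The sums increase with the leaf, and since every center precedes every leaf, two of them differ
  -- by less than `e y - e (F.partner x) < N`.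
  have hne : ∀ x ∈ F.leaves, ∀ y ∈ F.leaves, e y ≠ Fin.last N → e x < e y →
      ((e x + e (F.partner x) : ℕ) : ZMod N) ≠ ((e y + e (F.partner y) : ℕ) : ZMod N) := by
    intro x hx y hy hyN hxy h
    have hpartner := hle x hx y hy hxy.le
    have hcenter := hlt _ (F.partner_notMem_leaves y hy) x hx
    have hdvd := (Nat.modEq_iff_dvd' (by omega)).1 ((ZMod.natCast_eq_natCast_iff _ _ _).1 h)
    have := Nat.le_of_dvd (by omega) hdvd
    have : (e y : ℕ) < N := Fin.val_lt_last hyN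
    omega
  rintro x ⟨hx, hxN⟩ y ⟨hy, hyN⟩ h
  simp only [← Nat.cast_add] at h
  rcases lt_trichotomy (e x) (e y) with hxy | hxy | hxy
  · exact (hne x hx y hy (mt e.eq_symm_apply.2 hyN) hxy h).elim
  · exact e.injective hxy
  · exact (hne y hy x hx (mt e.eq_symm_apply.2 hxN) hxy h.symm).elim

end StarForest

section Card

theorem injective_add_self_zmod {N : ℕ} (hN : Odd N) :
    Function.Injective fun a : ZMod N => a + a := by
  intro a b h
  refine sub_eq_zero.1 ((ZMod.add_self_eq_zero_iff_eq_zero hN).1 ?_)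
  rw [sub_add_sub_comm, sub_eq_zero.2 h]

variable {V : Type*} {G : SimpleGraph V} [Fintype V]

theorem totalColorable_of_card_le_of_odd {N : ℕ} (hN : Odd N) (hV : Fintype.card V ≤ N) :
    TotalColorable G N := by
  have : NeZero N := ⟨hN.pos.ne'⟩
  obtain ⟨label⟩ : Nonempty (V ↪ ZMod N) :=
    Function.Embedding.nonempty_of_card_le (by simpa using hV)
  simpa using totalColorable_card_of_injective_add_self (G := G) label.injective
    (injective_add_self_zmod hN)

theorem totalColorable_of_odd_of_forall_not_isUniversal {N : ℕ} (hN : Odd N)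
    (hV : Fintype.card V = N + 1) (hG : ∀ x, ¬ G.IsUniversal x) : TotalColorable G (N + 1) := by
  have : NeZero N := ⟨hN.pos.ne'⟩
  obtain ⟨F⟩ := nonempty_starForest fun x => isIsolated_compl_iff_isUniversal.not.2 (hG x)
  obtain ⟨e, hlt, hle⟩ := F.exists_equiv_fin_monotone hV
  let label : V → ZMod N := fun x => (e x : ℕ)
  let l : V := e.symm (Fin.last N)
  have hval : ∀ x ≠ l, (e x : ℕ) < N := fun x hx =>
    Fin.val_lt_last fun h => hx (e.eq_symm_apply.2 h)
  have hlabel : Set.InjOn label {l}ᶜ := fun x hx y hy h =>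
    e.injective (Fin.ext (CharP.natCast_injOn_Iio (ZMod N) N (hval x hx) (hval y hy) h))
  have hl : l ∈ F.leaves := by
    by_contra hl
    have hlast : Fin.last N < e (F.partner l) := by
      simpa only [l, e.apply_symm_apply] using hlt l hl _ (F.partner_mem_leaves l hl)
    exact hlast.not_ge (Fin.le_last _)
  have hF : Set.InjOn (fun x => roundRobin label l (F.edge x)) (F.leaves \ {l}) := by
    refine (F.natCast_add_injOn hlt hle).congr fun x hx => ?_
    have : F.partner x ≠ l := fun h => F.partner_notMem_leaves x hx.1 (h ▸ hl)
    exact (roundRobin_of_ne (label := label) hx.2 this).symm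
  simpa using totalColorable_of_starForest_compl _
    (roundRobin_injOn hlabel (injective_add_self_zmod hN)) F hl hF

theorem totalColorable_card_of_forall_not_isUniversal [Nonempty V] (hG : ∀ x, ¬ G.IsUniversal x) :
    TotalColorable G (Fintype.card V) := by
  rcases Nat.even_or_odd (Fintype.card V) with hV | hV
  · obtain ⟨N, hN⟩ := Nat.exists_eq_succ_of_ne_zero (Fintype.card_ne_zero (α := V))
    rw [hN] at hV ⊢
    exact totalColorable_of_odd_of_forall_not_isUniversal (by grind) hN hG
  · exact totalColorable_of_card_le_of_odd hV le_rfl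

theorem totalColorable_card_add_one : TotalColorable G (Fintype.card V + 1) := by
  rcases Nat.even_or_odd (Fintype.card V) with hV | hV
  · exact totalColorable_of_card_le_of_odd hV.add_one (Nat.le_succ _)
  · exact (totalColorable_of_card_le_of_odd hV le_rfl).mono_colors (Nat.le_succ _)

theorem totalColorable_add_two_of_card_le [Nonempty V] [DecidableRel G.Adj] {m : ℕ}
    (hdeg : G.maxDegree ≤ m) (hV : Fintype.card V ≤ m + 2) : TotalColorable G (m + 2) := by
  by_cases hG : ∃ x, G.IsUniversal x
  · obtain ⟨x, hx⟩ := hG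
    have := (G.degree_eq_card_sub_one x).2 hx
    have := G.degree_le_maxDegree x
    exact totalColorable_card_add_one.mono_colors (by omega)
  · exact (totalColorable_card_of_forall_not_isUniversal (not_exists.1 hG)).mono_colors hV

end Card

section Induce

variable {V : Type*} {G : SimpleGraph V} {S : Set V} {u v : V}

theorem spanningCoe_induce_adj :
    (G.induce S).spanningCoe.Adj u v ↔ u ∈ S ∧ v ∈ S ∧ G.Adj u v := by
  simp only [map_adj, comap_adj]
  aesop

variable [Fintype V] [DecidableRel G.Adj]

theorem totalColorable_spanningCoe_induce_of_ncard_le (hS : S.Nonempty)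
    (hcard : S.ncard ≤ G.maxDegree + 2) :
    TotalColorable (G.induce S).spanningCoe (G.maxDegree + 2) := by
  classical
  have : Nonempty S := hS.to_subtype
  refine TotalColorable.spanningCoe (totalColorable_add_two_of_card_le ?_ ?_)
  · exact (Embedding.induce S).toCopy.maxDegree_mono
  · rwa [← Nat.card_eq_fintype_card, Nat.card_coe_set_eq]

theorem TotalColorable.spanningCoe_induce_insert
    (h : TotalColorable (G.induce S).spanningCoe (G.maxDegree + 2))
    (hv : v ∉ S) (hnbr : (G.neighborSet v ∩ S).Subsingleton) :
    TotalColorable (G.induce (insert v S)).spanningCoe (G.maxDegree + 2) := by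
  classical
  have hle : ∀ H : SimpleGraph V, (G.induce S).spanningCoe ≤ H →
      (∀ u ∈ S, G.Adj v u → H.Adj u v) → (G.induce (insert v S)).spanningCoe ≤ H := by
    intro H hSH hvH x y hxy
    obtain ⟨hx | hx, hy | hy, hadj⟩ := spanningCoe_induce_adj.1 hxy
    · exact (hadj.ne (hx.trans hy.symm)).elim
    · exact hx ▸ (hvH y hy (hx ▸ hadj)).symm
    · exact hy ▸ hvH x hx (hy ▸ hadj.symm)
    · exact hSH (spanningCoe_induce_adj.2 ⟨hx, hy, hadj⟩)
  rcases hnbr.eq_empty_or_singleton with hempty | ⟨u, hu⟩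
  · refine h.mono (hle _ le_rfl fun u huS hvu => ?_)
    exact (Set.eq_empty_iff_forall_notMem.1 hempty u ⟨hvu, huS⟩).elim
  · obtain ⟨hvu, huS⟩ : u ∈ G.neighborSet v ∩ S := hu ▸ Set.mem_singleton u
    have hdeg : (G.induce S).spanningCoe.degree u < G.degree u := by
      refine Finset.card_lt_card (Finset.ssubset_iff_exists_subset_erase.2 ⟨v, ?_, fun x hx => ?_⟩)
      · simpa using hvu.symm
      · have hux := spanningCoe_induce_adj.1 ((mem_neighborFinset _ _ _).1 hx)
        exact Finset.mem_erase.2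
          ⟨fun hxv => hv (hxv ▸ hux.2.1), (mem_neighborFinset _ _ _).2 hux.2.2⟩
    have := G.degree_le_maxDegree u
    refine (h.sup_edge hvu.ne' ?_ (by omega) (by omega)).mono (hle _ le_sup_left ?_)
    · exact fun x hx => hv (spanningCoe_induce_adj.1 hx).1
    · intro x hxS hvx
      obtain rfl : x = u := hnbr ⟨hvx, hxS⟩ ⟨hvu, huS⟩
      simp [edge_adj, hvu.ne']

end Induce

section InitialSegment

variable {V : Type*} {G : SimpleGraph V} {n : ℕ} (σ : Fin n ≃ V)

/-- The set of the first `k` vertices of the ordering `σ`. -/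
def initialSegment (k : ℕ) : Set V := {x | (σ.symm x : ℕ) < k}

theorem initialSegment_zero : initialSegment σ 0 = ∅ := by
  simp [initialSegment]

theorem initialSegment_self : initialSegment σ n = Set.univ := by
  simp [initialSegment]

theorem initialSegment_succ (i : Fin n) :
    initialSegment σ (i + 1) = insert (σ i) (initialSegment σ i) := by
  ext x
  simp only [initialSegment, Set.mem_ofPred_eq, Set.mem_insert_iff, Nat.lt_succ_iff_lt_or_eq,
    or_comm, ← Fin.ext_iff, Equiv.symm_apply_eq]

theorem notMem_initialSegment (i : Fin n) : σ i ∉ initialSegment σ i := by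
  simp [initialSegment]

theorem ncard_initialSegment_le (k : ℕ) : (initialSegment σ k).ncard ≤ k := by
  calc (initialSegment σ k).ncard ≤ (Set.Iio k).ncard :=
        Set.ncard_le_ncard_of_injOn (fun x => (σ.symm x : ℕ)) (fun _ hx => hx)
          (fun x _ y _ h => σ.symm.injective (Fin.ext h))
    _ = k := Set.ncard_Iio_nat k

theorem initialDegree_eq_ncard (i : Fin n) :
    G.initialDegree σ i = (G.neighborSet (σ i) ∩ initialSegment σ i).ncard := by
  let : Fintype V := Fintype.ofEquiv (Fin n) σ
  classical
  unfold initialDegree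
  rw [← card_neighborSet_eq_degree, ← Nat.card_eq_fintype_card, Nat.card_coe_set_eq,
    ← Set.ncard_image_of_injective _ Subtype.val_injective]
  congr 1
  ext x
  simp only [Set.mem_image, mem_neighborSet, comap_adj, Function.Embedding.subtype_apply,
    Subtype.exists, initialSegment, Set.mem_inter_iff, Set.mem_ofPred_eq]
  constructor
  · rintro ⟨y, ⟨j, hj, rfl⟩, hadj, rfl⟩
    refine ⟨hadj, ?_⟩
    rw [σ.symm_apply_apply]
    exact lt_of_le_of_ne hj fun h => hadj.ne (by rw [Fin.ext h])
  · rintro ⟨hadj, hlt⟩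
    exact ⟨x, ⟨_, le_of_lt hlt, σ.apply_symm_apply x⟩, hadj, rfl⟩

end InitialSegment

section MockThreshold

variable {V : Type*} [Fintype V] {G : SimpleGraph V} [DecidableRel G.Adj]

theorem initialDegree_le_maxDegree {n : ℕ} (σ : Fin n ≃ V) (i : Fin n) :
    G.initialDegree σ i ≤ G.maxDegree := by
  rw [initialDegree_eq_ncard]
  calc (G.neighborSet (σ i) ∩ initialSegment σ i).ncard ≤ (G.neighborSet (σ i)).ncard :=
        Set.ncard_le_ncard Set.inter_subset_left
    _ = G.degree (σ i) := by
        rw [← Nat.card_coe_set_eq, Nat.card_eq_fintype_card, card_neighborSet_eq_degree]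
    _ ≤ G.maxDegree := G.degree_le_maxDegree _

theorem totalColorable_initialSegment {n : ℕ} (σ : Fin n ≃ V)
    (hσ : ∀ i : Fin n, G.initialDegree σ i ≤ 1 ∨ (i : ℕ) ≤ G.initialDegree σ i + 1) :
    ∀ k ≤ n, TotalColorable (G.induce (initialSegment σ k)).spanningCoe (G.maxDegree + 2) := by
  intro k hk
  induction k with
  | zero =>
    refine totalColorable_bot.mono fun x y hxy => ?_
    simp [initialSegment_zero] at hxy
  | succ k ih =>
    let i : Fin n := ⟨k, hk⟩
    have hsucc : initialSegment σ (k + 1) = insert (σ i) (initialSegment σ k) :=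
      initialSegment_succ σ i
    rcases hσ i with hsmall | hlarge
    · rw [initialDegree_eq_ncard, Set.ncard_le_one_iff_subsingleton] at hsmall
      rw [hsucc]
      exact (ih (by omega)).spanningCoe_induce_insert (notMem_initialSegment σ i) hsmall
    · have : k ≤ G.initialDegree σ i + 1 := hlarge
      have := ncard_initialSegment_le σ (k + 1)
      have := initialDegree_le_maxDegree (G := G) σ i
      exact totalColorable_spanningCoe_induce_of_ncard_le (hsucc ▸ Set.insert_nonempty _ _)
        (by omega)

theorem totalColorable_of_isMockThreshold (hG : G.IsMockThreshold) :
    TotalColorable G (G.maxDegree + 2) := by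
  obtain ⟨σ, hσ⟩ := hG
  have hcol := totalColorable_initialSegment (G := G) σ
    (fun i => by have := hσ i; omega) _ le_rfl
  rwa [initialSegment_self, spanningCoe_induce_univ] at hcol

end MockThreshold

theorem mainTheorem6 {V : Type*} [Fintype V] (G : SimpleGraph V) [DecidableRel G.Adj]
    (hG : G.IsMockThreshold) :
    G.totalChromaticNumber ≤ (G.maxDegree : ℕ∞) + 2 := by
  exact_mod_cast (totalColorable_of_isMockThreshold hG).totalChromaticNumber_le
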